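/- For a permutation $\sigma$ of $[n]=\{1,\dots,n\}$ let $\mathrm{inv}(\sigma)$, $\mathrm{fix}(\sigma)$ and $\mathrm{exc}(\sigma)$ be the numbers of pairs $i<j$ with $\sigma(i)>\sigma(j)$, of $i$ with $\sigma(i)=i$, and of $i$ with $\sigma(i)>i$, respectively, and let $$\mathrm{depth}(\sigma)=\min\Big\{\sum_{r=1}^k (j_r-i_r) : \sigma=(i_1\,j_1)(i_2\,j_2)\cdots(i_k\,j_k),\ i_r<j_r\Big\}.$$ A 3-colored Motzkin path of length $n$ is a lattice path from $(0,0)$ to $(n,0)$ that stays weakly above the $x$-axis, with up steps $U=(1,1)$, down steps $D=(1,-1)$ and horizontal steps $(1,0)$ of three kinds $H_1,H_2,H_3$. The height of a step is the largest $y$-coordinate on it; $x^{(h)}$ denotes a step $x$ of height $h$. Let $q,p,s,t$ be indeterminates, and let $\mathcal W_n$ be the set of 3-colored Motzkin paths of length $n$ in which each step carries one weight, chosen as follows: for $h\ge 1$, $$\omega(U^{(h)})\in\{st^{2h-1}q^{d}\},\quad \omega(D^{(h)})\in\{q^{2h-1+d}\},\quad \omega(H_1^{(h)})\in\{st^hq^{h+d}\},\quad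 \omega(H_2^{(h)})\in\{t^hq^{h+d}\},$$ where $0\le d\le h-1$ in each case, and $\omega(H_3^{(h)})=pt^hq^{2h}$; at height $0$ only $H_3$ is allowed, with $\omega(H_3^{(0)})=p$. The weight $\omega(\mu)$ of $\mu\in\mathcal W_n$ is the product of the weights of its steps. Then for every $n\ge 0$ there is a bijection $\Psi:\mathfrak S_n\to\mathcal W_n$ such that, for all $\sigma\in\mathfrak S_n$, $$\omega(\Psi(\sigma))=q^{\mathrm{inv}(\sigma)}p^{\mathrm{fix}(\sigma)}s^{\mathrm{exc}(\sigma)}t^{\mathrm{depth}(\sigma)}.$$ Moreover, as formal power series in $z$ over $\mathbb Z[q,p,s,t]$, $$\sum_{n\ge 0}\Big(\sum_{\sigma\in\mathfrak S_n}q^{\mathrm{inv}(\sigma)}p^{\mathrm{fix}(\sigma)}s^{\mathrm{exc}(\sigma)}t^{\mathrm{depth}(\sigma)}\Big)z^n=\cfrac{1}{1-\gamma_0z-\cfrac{\lambda_1z^2}{1-\gamma_1z-\cfrac{\lambda_2z^2}{1-\gamma_2z-\cfrac{\lambda_3z^2}{\ddots}}}},$$ where $\lambda_h=s\,[h]_q^2\,(qt)^{2h-1}$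 for $h\ge1$, $\gamma_h=\big((1+s)[h]_q+pq^h\big)(qt)^h$ for $h\ge0$, $[h]_q=1+q+\cdots+q^{h-1}$ and $[0]_q=0$; the continued fraction is the coefficientwise limit of its finite truncations. -/

import Mathlib

open scoped PowerSeries

namespace MotzkinPerm

/-! ### Permutation statistics -/

/-- The number of inversions: pairs of indices `i < j` with `σ i > σ j`. -/
def inv {n : ℕ} (σ : Equiv.Perm (Fin n)) : ℕ :=
  (Finset.univ.filter fun x : Fin n × Fin n => x.1 < x.2 ∧ σ x.2 < σ x.1).card

/-- The number of fixed points. -/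
def fix {n : ℕ} (σ : Equiv.Perm (Fin n)) : ℕ :=
  (Finset.univ.filter fun i : Fin n => σ i = i).card

/-- The number of excedances: indices `i` with `σ i > i`. -/
def exc {n : ℕ} (σ : Equiv.Perm (Fin n)) : ℕ :=
  (Finset.univ.filter fun i : Fin n => i < σ i).card

/-- `l = [(i₁, j₁), …, (iₖ, jₖ)]` is a factorization
`σ = (i₁ j₁) ⋯ (iₖ jₖ)` into transpositions, with `iᵣ < jᵣ` for all `r`. -/
def IsFactorization {n : ℕ} (σ : Equiv.Perm (Fin n)) (l : List (Fin n × Fin n)) : Prop :=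
  (∀ x ∈ l, x.1 < x.2) ∧ σ = (l.map fun x => Equiv.swap x.1 x.2).prod

/-- The cost `∑ᵣ (jᵣ - iᵣ)` of a factorization. -/
def cost {n : ℕ} (l : List (Fin n × Fin n)) : ℕ :=
  (l.map fun x => (x.2 : ℕ) - (x.1 : ℕ)).sum

/-- The depth of a permutation: the minimal cost of a factorization into transpositions. -/
noncomputable def depth {n : ℕ} (σ : Equiv.Perm (Fin n)) : ℕ :=
  sInf {d | ∃ l, IsFactorization σ l ∧ cost l = d}

/-- Every permutation has a factorization, so that the minimum defining the depth is attained. -/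
theorem exists_isFactorization {n : ℕ} (σ : Equiv.Perm (Fin n)) :
    ∃ l, IsFactorization σ l := by
  induction σ using Equiv.Perm.swap_induction_on with
  | one => exact ⟨[], by simp [IsFactorization]⟩
  | swap_mul f x y hxy ih =>
    obtain ⟨l, h1, h2⟩ := ih
    rcases lt_or_gt_of_ne hxy with h | h
    · refine ⟨(x, y) :: l, ?_, by simp [← h2]⟩
      simpa [h] using h1
    · refine ⟨(y, x) :: l, ?_, by simp [← h2, Equiv.swap_comm y x]⟩
      simpa [h] using h1

theorem exists_cost_eq_depth {n : ℕ} (σ : Equiv.Perm (Fin n)) :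
    ∃ l, IsFactorization σ l ∧ cost l = depth σ := by
  obtain ⟨l, hl⟩ := exists_isFactorization σ
  exact Nat.sInf_mem (s := {d | ∃ l, IsFactorization σ l ∧ cost l = d}) ⟨_, l, hl, rfl⟩

/-! ### The coefficient ring `ℤ[q, p, s, t]` -/

/-- Polynomials over `ℤ` in the four indeterminates `q, p, s, t`. -/
abbrev Poly : Type := MvPolynomial (Fin 4) ℤ

/-- The indeterminate `q`. -/
noncomputable def q : Poly := MvPolynomial.X 0
/-- The indeterminate `p`. -/
noncomputable def p : Poly := MvPolynomial.X 1
/-- The indeterminate `s`. -/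
noncomputable def s : Poly := MvPolynomial.X 2
/-- The indeterminate `t`. -/
noncomputable def t : Poly := MvPolynomial.X 3

/-- The `q`-integer `[k]_q = 1 + q + ⋯ + q^(k-1)`, with `[0]_q = 0`. -/
noncomputable def qInt (k : ℕ) : Poly := ∑ i ∈ Finset.range k, q ^ i

/-! ### Weighted 3-colored Motzkin paths -/

/-- Up steps, down steps, and horizontal steps of three colors. -/
inductive Step : Type
  | U | D | H1 | H2 | H3

/-- The change of the `y`-coordinate along a step. -/
def Step.dy : Step → ℤ
  | U => 1
  | D => -1
  | H1 => 0
  | H2 => 0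
  | H3 => 0

/-- The `y`-coordinate reached after the first `k` steps, starting from the origin. -/
def yCoord {n : ℕ} (x : Fin n → Step) (k : ℕ) : ℤ :=
  ∑ i : Fin n with i.val < k, (x i).dy

/-- The sequence of steps stays weakly above the `x`-axis and ends at `(n, 0)`. -/
def IsMotzkin {n : ℕ} (x : Fin n → Step) : Prop :=
  (∀ k ≤ n, 0 ≤ yCoord x k) ∧ yCoord x n = 0

/-- The height of the `i`-th step: the maximal `y`-coordinate achieved by it
(a nonnegative integer when the path is a Motzkin path). -/
def height {n : ℕ} (x : Fin n → Step) (i : Fin n) : ℕ :=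
  (max (yCoord x i.val) (yCoord x (i.val + 1))).toNat

/-- The set of admissible weights of a step at height `h`. At height `0` no weight is admissible
for `U`, `D`, `H1`, `H2`, and the only one for `H3` is `p`. -/
def stepWeights : Step → ℕ → Set Poly
  | .U, h => {w | ∃ d < h, w = s * t ^ (2 * h - 1) * q ^ d}
  | .D, h => {w | ∃ d < h, w = q ^ (2 * h - 1 + d)}
  | .H1, h => {w | ∃ d < h, w = s * t ^ h * q ^ (h + d)}
  | .H2, h => {w | ∃ d < h, w = t ^ h * q ^ (h + d)}
  | .H3, h => {p * t ^ h * q ^ (2 * h)}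

/-- The set `𝒲_n`: 3-colored Motzkin paths of length `n` together with a choice of an admissible
weight for each step. -/
@[ext] structure WeightedPath (n : ℕ) : Type where
  /-- the steps of the path -/
  step : Fin n → Step
  /-- the weights of the steps -/
  stepWeight : Fin n → Poly
  isMotzkin : IsMotzkin step
  stepWeight_mem : ∀ i, stepWeight i ∈ stepWeights (step i) (height step i)

/-- The weight of a weighted path: the product of the weights of its steps. -/
noncomputable def WeightedPath.weight {n : ℕ} (μ : WeightedPath n) : Poly :=
  ∏ i, μ.stepWeight i

/-! ### J-fractions -/

/-- The `k`-th convergent of the J-fraction that starts at level `h`,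
`1 / (1 - γ_h z - λ_{h+1} z² / (1 - γ_{h+1} z - λ_{h+2} z² / ⋯))`,
where the fraction below the `k`-th level is replaced by `0`. The denominators have constant
coefficient `1`, and `invOfUnit _ 1` is their inverse as formal power series. -/
noncomputable def jConvergent {R : Type*} [CommRing R] (γ lam : ℕ → R) : ℕ → ℕ → R⟦X⟧
  | 0, _ => 0
  | k + 1, h =>
    PowerSeries.invOfUnit
      (1 - PowerSeries.C (γ h) * PowerSeries.X
        - PowerSeries.C (lam (h + 1)) * PowerSeries.X ^ 2 * jConvergent γ lam k (h + 1)) 1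

theorem jConvergent_succ_mul {R : Type*} [CommRing R] (γ lam : ℕ → R) (k h : ℕ) :
    (1 - PowerSeries.C (γ h) * PowerSeries.X
      - PowerSeries.C (lam (h + 1)) * PowerSeries.X ^ 2 * jConvergent γ lam k (h + 1))
      * jConvergent γ lam (k + 1) h = 1 := by
  rw [jConvergent]
  exact PowerSeries.mul_invOfUnit _ 1 (by simp)

/-- Consecutive convergents agree modulo `z^(2k)`. -/
theorem X_pow_dvd_jConvergent_sub {R : Type*} [CommRing R] (γ lam : ℕ → R) (k h : ℕ) :
    (PowerSeries.X : R⟦X⟧) ^ (2 * k) ∣ jConvergent γ lam (k + 1) h - jConvergent γ lam k h := by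
  induction k generalizing h with
  | zero => simp
  | succ k ih =>
    obtain ⟨c, hc⟩ := ih (h + 1)
    have h1 := jConvergent_succ_mul γ lam k h
    have h2 := jConvergent_succ_mul γ lam (k + 1) h
    refine ⟨PowerSeries.C (lam (h + 1)) * c * jConvergent γ lam (k + 1) h
      * jConvergent γ lam (k + 1 + 1) h, ?_⟩
    have e : (PowerSeries.X : R⟦X⟧) ^ (2 * (k + 1)) = PowerSeries.X ^ 2 * PowerSeries.X ^ (2 * k) := by
      ring
    rw [e]
    linear_combination (PowerSeries.C (lam (h + 1)) * PowerSeries.X ^ 2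
      * jConvergent γ lam (k + 1) h * jConvergent γ lam (k + 1 + 1) h) * hc
      - jConvergent γ lam (k + 1 + 1) h * h1 + jConvergent γ lam (k + 1) h * h2

/-- The J-fraction
`1 / (1 - γ_0 z - λ_1 z² / (1 - γ_1 z - λ_2 z² / (1 - γ_2 z - ⋯)))` as a formal power series in `z`:
the coefficientwise limit of its convergents. -/
noncomputable def jFraction {R : Type*} [CommRing R] (γ lam : ℕ → R) : R⟦X⟧ :=
  PowerSeries.mk fun n => PowerSeries.coeff n (jConvergent γ lam (n + 1) 0)

/-- The coefficient of `z^n` in the `k`-th convergent is that of the J-fraction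
as soon as `k > n`. -/
theorem coeff_jConvergent {R : Type*} [CommRing R] (γ lam : ℕ → R) {n k : ℕ} (hk : n < k) :
    PowerSeries.coeff n (jConvergent γ lam k 0) = PowerSeries.coeff n (jFraction γ lam) := by
  rw [jFraction, PowerSeries.coeff_mk]
  induction k, hk using Nat.le_induction with
  | base => rfl
  | succ k hk ih =>
    rw [← ih, ← sub_eq_zero, ← map_sub]
    exact PowerSeries.X_pow_dvd_iff.mp (X_pow_dvd_jConvergent_sub γ lam k 0) n (by omega)

end MotzkinPerm

/-! The depth of `σ` equals the sum of `σ i - i` over its excedances (`depth_eq_excSum`). Left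
multiplication by a transposition `(a b)` raises this sum by at most `b - a`, and every `σ ≠ 1`
admits a transposition that lowers it by exactly its cost.

Let `A(n, h)` be the generating polynomial of the permutation matrices of size `n` with no cell in
the upper left `h × h` block (`avoidSum`). The parts of row `h` and column `h` (counted from 0)
lying in the `(h+1) × (h+1)` block contain either no cell, or the cell `(h, h)`, or one other cell
in the row, or one other cell in the column, or one in each. Deleting these cells with their rows
and columns gives `A(n+1, h) = A(n+1, h+1) + γ_h A(n, h) + λ_h A(n-1, h-1)`, the free coordinate of
each deleted off-diagonal cell supplying a factor `[h]_q` (`avoidSum_split`, `avoidSum_succ_succ`).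
This is the first-step recursion for Motzkin paths with `n + 1 - h` steps from height `h` to `0`,
where up steps weigh `1` and down steps `λ_h`. Redistributing weight between up and down steps of
the same height does not change the sum over paths from `0` to `0`, so `A(n, 0)` is the total weight
of `𝒲_n`; Flajolet's argument turns the same path sums into the J-fraction.

The bijection is not constructed: both sides are finite families of monic monomials with equal sums,
so every monomial occurs equally often in both, and the fibres can be matched arbitrarily
(`exists_bijective_of_sum_eq`). -/

namespace MotzkinPerm

/-! ### The depth is the total size of the excedances -/

/-- The total displacement `∑ (σ i - i)` over the excedances `i` of `σ`. -/
def excSum {n : ℕ} (σ : Equiv.Perm (Fin n)) : ℕ := ∑ i, ((σ i : ℕ) - (i : ℕ))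

/-- Composing on the left exchanges the values `a` and `b`, so only the position carrying the value
`a` can gain displacement, and it gains at most `b - a`. -/
theorem excSum_swap_mul_le {n : ℕ} (σ : Equiv.Perm (Fin n)) {a b : Fin n} (hab : a < b) :
    excSum (Equiv.swap a b * σ) ≤ ((b : ℕ) - a) + excSum σ := by
  have h1 : ∀ i, ((Equiv.swap a b * σ) i : ℕ) - (i : ℕ) ≤
      ((σ i : ℕ) - i) + if i = σ.symm a then (b : ℕ) - a else 0 := by
    intro i
    have hab' : (a : ℕ) < b := hab
    simp only [Equiv.Perm.mul_apply, Equiv.swap_apply_def, Equiv.eq_symm_apply]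
    split_ifs with h h' <;> simp_all <;> omega
  calc excSum (Equiv.swap a b * σ) ≤ _ := Finset.sum_le_sum fun i _ => h1 i
    _ = _ := by
      rw [Finset.sum_add_distrib, Finset.sum_ite_eq' Finset.univ (σ.symm a), excSum]
      simp [add_comm]

theorem excSum_one {n : ℕ} : excSum (1 : Equiv.Perm (Fin n)) = 0 := by simp [excSum]

theorem excSum_le_cost {n : ℕ} (l : List (Fin n × Fin n)) (hl : ∀ x ∈ l, x.1 < x.2) :
    excSum (l.map fun x => Equiv.swap x.1 x.2).prod ≤ cost l := by
  induction l with
  | nil => simp [excSum_one]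
  | cons x l ih =>
    have := excSum_swap_mul_le (l.map fun x => Equiv.swap x.1 x.2).prod (hl x (by simp))
    have := ih fun y hy => hl y (by simp [hy])
    simp only [List.map_cons, List.prod_cons, cost, List.sum_cons] at *
    omega

theorem eq_one_of_apply_le {n : ℕ} {σ : Equiv.Perm (Fin n)} (h : ∀ i, σ i ≤ i) : σ = 1 := by
  have h1 : ∑ i : Fin n, ((i : ℕ) - (σ i : ℕ)) = 0 := by
    zify
    rw [Finset.sum_congr rfl fun i _ => Nat.cast_sub (h i), Finset.sum_sub_distrib,
      Equiv.sum_comp σ fun i => ((i : ℕ) : ℤ), sub_self]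
  ext i
  have h2 := (Finset.sum_eq_zero_iff.mp h1) i (Finset.mem_univ i)
  have h3 : (σ i : ℕ) ≤ i := h i
  simp only [Equiv.Perm.one_apply]
  omega

/-- A permutation other than the identity has a reducible pair of positions. -/
theorem exists_reducible_pair {n : ℕ} {σ : Equiv.Perm (Fin n)} (hσ : σ ≠ 1) :
    ∃ i j, i < j ∧ j ≤ σ i ∧ σ j ≤ i := by
  have hne : (Finset.univ.filter fun i => i < σ i).Nonempty := by
    by_contra h
    rw [Finset.not_nonempty_iff_eq_empty, Finset.filter_eq_empty_iff] at h
    exact hσ (eq_one_of_apply_le fun i => not_lt.mp (h (Finset.mem_univ i)))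
  -- Take the largest excedance `i`. No position `j > i` is an excedance, so if no pair `(i, j)`
  -- worked, `σ` would inject `(i, σ i]` into the smaller interval `(i, σ i)`.
  obtain ⟨i, hi, hmax⟩ := Finset.exists_max_image _ id hne
  simp only [Finset.mem_filter, Finset.mem_univ, true_and, id] at hi hmax
  by_contra! hcon
  have hmap : ∀ j ∈ Finset.Ioc i (σ i), σ j ∈ Finset.Ioo i (σ i) := by
    intro j hj
    rw [Finset.mem_Ioc] at hj
    have h1 : i < σ j := hcon i j hj.1 hj.2
    have h2 : σ j ≤ j := not_lt.mp fun h => absurd (hmax j h) (not_le.mpr hj.1)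
    have h3 : σ j ≠ σ i := fun h => hj.1.ne' (σ.injective h)
    exact Finset.mem_Ioo.mpr ⟨h1, lt_of_le_of_ne (h2.trans hj.2) h3⟩
  have := Finset.card_le_card_of_injOn σ hmap σ.injective.injOn
  rw [Fin.card_Ioc, Fin.card_Ioo] at this
  have : (i : ℕ) < σ i := hi
  omega

/-- The displacement `σ i - i` is replaced by `σ i - j` at position `j`. The value `σ j` contributes
nothing before or after the swap, since `σ j ≤ i < j`. -/
theorem excSum_mul_swap {n : ℕ} (σ : Equiv.Perm (Fin n)) {i j : Fin n} (hij : i < j)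
    (hj : j ≤ σ i) (hi : σ j ≤ i) :
    excSum (σ * Equiv.swap i j) + ((j : ℕ) - i) = excSum σ := by
  have hij' : (i : ℕ) < j := hij
  have hj' : (j : ℕ) ≤ σ i := hj
  have hi' : (σ j : ℕ) ≤ i := hi
  have h1 : ∀ k, (((σ * Equiv.swap i j) k : ℕ) - (k : ℕ)) + (if k = i then (σ i : ℕ) - i else 0) =
      ((σ k : ℕ) - k) + if k = j then (σ i : ℕ) - j else 0 := by
    intro k
    rw [Equiv.Perm.mul_apply, Equiv.swap_apply_def]
    split_ifs with h h' <;> simp_all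
    · omega
  have h2 := Finset.sum_congr (rfl : Finset.univ = Finset.univ) fun k _ => h1 k
  rw [Finset.sum_add_distrib, Finset.sum_add_distrib, Finset.sum_ite_eq' Finset.univ i,
    Finset.sum_ite_eq' Finset.univ j] at h2
  simp only [Finset.mem_univ, if_true] at h2
  rw [excSum, excSum]
  omega

theorem exists_factorization_cost_eq {n : ℕ} (m : ℕ) (σ : Equiv.Perm (Fin n))
    (hm : excSum σ = m) : ∃ l, IsFactorization σ l ∧ cost l = m := by
  induction m using Nat.strong_induction_on generalizing σ with
  | _ m ih =>
    by_cases hσ : σ = 1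
    · exact ⟨[], by simp [IsFactorization, hσ], by simp [cost, ← hm, hσ, excSum_one]⟩
    obtain ⟨i, j, hij, hj, hi⟩ := exists_reducible_pair hσ
    have h1 := excSum_mul_swap σ hij hj hi
    have hij' : (i : ℕ) < j := hij
    obtain ⟨l, ⟨hl, hprod⟩, hcost⟩ := ih _ (by omega) (σ * Equiv.swap i j) rfl
    refine ⟨l ++ [(i, j)], ⟨?_, ?_⟩, ?_⟩
    · intro x hx
      rcases List.mem_append.mp hx with h | h
      · exact hl x h
      · rw [List.mem_singleton.mp h]; exact hij
    · rw [List.map_append, List.prod_append, ← hprod]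
      simp [mul_assoc]
    · simp only [cost, List.map_append, List.sum_append, List.map_cons, List.map_nil,
        List.sum_singleton] at hcost ⊢
      omega

theorem depth_eq_excSum {n : ℕ} (σ : Equiv.Perm (Fin n)) : depth σ = excSum σ := by
  apply le_antisymm
  · exact Nat.sInf_le (exists_factorization_cost_eq _ σ rfl)
  · obtain ⟨l, ⟨hl, hσ⟩, hc⟩ := exists_cost_eq_depth σ
    rw [← hc]
    conv_lhs => rw [hσ]
    exact excSum_le_cost l hl

/-! ### Inserting a cell into a permutation matrix -/

/-- The permutation whose matrix arises from that of `σ` by inserting a row and a column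
that meet in the cell `(i, j)`. -/
def insertCell {n : ℕ} (i j : Fin (n + 1)) (σ : Equiv.Perm (Fin n)) : Equiv.Perm (Fin (n + 1)) :=
  ((finSuccEquiv' i).trans (Equiv.optionCongr σ)).trans (finSuccEquiv' j).symm

@[simp] theorem insertCell_apply_self {n : ℕ} (i j : Fin (n + 1)) (σ : Equiv.Perm (Fin n)) :
    insertCell i j σ i = j := by simp [insertCell]

@[simp] theorem insertCell_apply_succAbove {n : ℕ} (i j : Fin (n + 1)) (σ : Equiv.Perm (Fin n))
    (k : Fin n) : insertCell i j σ (i.succAbove k) = j.succAbove (σ k) := by simp [insertCell]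

theorem insertCell_injective {n : ℕ} (i j : Fin (n + 1)) :
    Function.Injective (insertCell i j) := by
  intro σ τ h
  ext k
  have := congrArg (fun f => f (i.succAbove k)) h
  simp only [insertCell_apply_succAbove] at this
  rw [Fin.succAbove_right_injective this]

theorem exists_insertCell_eq {n : ℕ} {i j : Fin (n + 1)} (τ : Equiv.Perm (Fin (n + 1)))
    (h : τ i = j) : ∃ σ, insertCell i j σ = τ := by
  have hne : ∀ k, ∃ l, j.succAbove l = τ (i.succAbove k) := fun k =>
    Fin.exists_succAbove_eq fun h' => Fin.succAbove_ne i k (τ.injective (h'.trans h.symm))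
  choose f hf using hne
  have hinj : Function.Injective f := by
    intro a b hab
    have := hf a
    rw [hab, hf b] at this
    exact (Fin.succAbove_right_injective (τ.injective this)).symm
  refine ⟨Equiv.ofBijective f (Finite.injective_iff_bijective.mp hinj), ?_⟩
  ext k
  rcases Fin.eq_self_or_eq_succAbove i k with rfl | ⟨k, rfl⟩
  · simp [h]
  · simp [hf]

/-- Deletion of the prescribed cell `(i, j)` reindexes the sum by permutations of smaller size;
every case of the recursion is evaluated this way. -/
theorem sum_filter_apply_eq {n : ℕ} {M : Type*} [AddCommMonoid M] (i j : Fin (n + 1))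
    (P : Equiv.Perm (Fin (n + 1)) → Prop) [DecidablePred P]
    (Q : Equiv.Perm (Fin n) → Prop) [DecidablePred Q]
    (hPQ : ∀ σ, P (insertCell i j σ) ↔ Q σ)
    (f : Equiv.Perm (Fin (n + 1)) → M) :
    ∑ τ with P τ ∧ τ i = j, f τ = ∑ σ with Q σ, f (insertCell i j σ) := by
  symm
  refine Finset.sum_bij (fun σ _ => insertCell i j σ) ?_ ?_ ?_ ?_
  · intro σ hσ
    simpa [hPQ] using hσ
  · intro σ _ τ _ h
    exact insertCell_injective i j h
  · intro τ hτ
    simp only [Finset.mem_filter, Finset.mem_univ, true_and] at hτ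
    obtain ⟨σ, rfl⟩ := exists_insertCell_eq τ hτ.2
    exact ⟨σ, by simpa [hPQ] using hτ.1, rfl⟩
  · simp

/-- Under the hypothesis all `i` rows above the new cell have their cells to its right, and so all
`j` columns to its left have their cells below it. The new cell therefore forms exactly `i + j`
inversions. -/
theorem inv_insertCell {n : ℕ} (i j : Fin (n + 1)) (σ : Equiv.Perm (Fin n))
    (h : ∀ k : Fin n, (k : ℕ) < i → (j : ℕ) ≤ σ k) :
    inv (insertCell i j σ) = inv σ + i + j := by
  have hcard : ∀ (m : ℕ) (τ : Equiv.Perm (Fin m)),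
      inv τ = ∑ a, ∑ b, if a < b ∧ τ b < τ a then 1 else 0 := by
    intro m τ
    rw [inv, Finset.card_filter, Fintype.sum_prod_type]
  rw [hcard, hcard, Fin.sum_univ_succAbove _ i]
  simp only [Fin.sum_univ_succAbove _ i, insertCell_apply_self, insertCell_apply_succAbove,
    Fin.succAbove_lt_succAbove_iff, lt_self_iff_false, false_and, if_false, zero_add,
    Finset.sum_add_distrib]
  have h1 : ∀ k : Fin n, (i.succAbove k < i ∧ j < j.succAbove (σ k)) ↔ (k : ℕ) < i := by
    intro k
    rw [Fin.succAbove_lt_iff_castSucc_lt, Fin.lt_succAbove_iff_le_castSucc, Fin.lt_def, Fin.le_def]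
    exact ⟨fun h => h.1, fun h' => ⟨h', h k h'⟩⟩
  have h2 : ∀ k : Fin n, (i < i.succAbove k ∧ j.succAbove (σ k) < j) ↔ (σ k : ℕ) < j := by
    intro k
    rw [Fin.succAbove_lt_iff_castSucc_lt, Fin.lt_succAbove_iff_le_castSucc, Fin.lt_def, Fin.le_def]
    refine ⟨fun h => h.2, fun h' => ⟨?_, h'⟩⟩
    by_contra hk
    exact absurd (h k (by simpa using hk)) (by simpa using h')
  have h3 : ∀ c : Fin (n + 1), (∑ k : Fin n, if (k : ℕ) < c then 1 else 0) = (c : ℕ) := by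
    intro c
    rw [← Finset.card_filter, Fin.card_filter_val_lt]
    omega
  simp only [h1, h2, h3]
  rw [Equiv.sum_comp σ fun k : Fin n => if (k : ℕ) < j then 1 else 0, h3]
  omega

theorem fix_eq_sum {n : ℕ} (σ : Equiv.Perm (Fin n)) :
    fix σ = ∑ i, if (σ i : ℕ) = i then 1 else 0 := by
  simp only [fix, Finset.card_filter, Fin.ext_iff]

theorem exc_eq_sum {n : ℕ} (σ : Equiv.Perm (Fin n)) :
    exc σ = ∑ i : Fin n, if (i : ℕ) < σ i then 1 else 0 := by
  simp only [exc, Finset.card_filter, Fin.lt_def]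

theorem val_succAbove {n : ℕ} (i : Fin (n + 1)) (k : Fin n) :
    (i.succAbove k : ℕ) = if (k : ℕ) < i then (k : ℕ) else k + 1 := by
  simp only [Fin.succAbove, Fin.lt_def, Fin.val_castSucc]
  split_ifs <;> simp

theorem fix_insertCell {n : ℕ} (i j : Fin (n + 1)) (σ : Equiv.Perm (Fin n)) :
    fix (insertCell i j σ) = (if (j : ℕ) = i then 1 else 0) +
      ∑ k, if (j.succAbove (σ k) : ℕ) = i.succAbove k then 1 else 0 := by
  simp [fix_eq_sum, Fin.sum_univ_succAbove _ i]

theorem exc_insertCell {n : ℕ} (i j : Fin (n + 1)) (σ : Equiv.Perm (Fin n)) :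
    exc (insertCell i j σ) = (if (i : ℕ) < j then 1 else 0) +
      ∑ k, if (i.succAbove k : ℕ) < j.succAbove (σ k) then 1 else 0 := by
  simp [exc_eq_sum, Fin.sum_univ_succAbove _ i]

theorem excSum_insertCell {n : ℕ} (i j : Fin (n + 1)) (σ : Equiv.Perm (Fin n)) :
    excSum (insertCell i j σ) = ((j : ℕ) - i) +
      ∑ k, ((j.succAbove (σ k) : ℕ) - i.succAbove k) := by
  simp [excSum, Fin.sum_univ_succAbove _ i]

theorem sum_add_ite_val_lt {n c : ℕ} (f : Fin n → ℕ) (hc : c ≤ n) :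
    (∑ k : Fin n, (f k + if (k : ℕ) < c then 1 else 0)) = ∑ k, f k + c := by
  rw [Finset.sum_add_distrib, ← Finset.card_filter, Fin.card_filter_val_lt, min_eq_right hc]

/-! ### Permutations without a cell in the upper left square block -/

/-- No cell of the matrix of `σ` lies in the upper left `h × h` block. -/
def AvoidsBlock (h : ℕ) {n : ℕ} (σ : Equiv.Perm (Fin n)) : Prop :=
  ∀ i : Fin n, (i : ℕ) < h → h ≤ (σ i : ℕ)

instance (h : ℕ) {n : ℕ} : DecidablePred (AvoidsBlock h (n := n)) := fun σ =>
  inferInstanceAs (Decidable (∀ i : Fin n, (i : ℕ) < h → h ≤ (σ i : ℕ)))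

/-- The monomial recording the four statistics of a permutation. -/
noncomputable def permWeight {n : ℕ} (σ : Equiv.Perm (Fin n)) : Poly :=
  q ^ inv σ * p ^ fix σ * s ^ exc σ * t ^ excSum σ

/-- The generating polynomial of the permutations without a cell in the upper left block. -/
noncomputable def avoidSum (n h : ℕ) : Poly :=
  ∑ σ : Equiv.Perm (Fin n) with AvoidsBlock h σ, permWeight σ

section Insert

variable {n h : ℕ}

theorem avoidsBlock_insertCell_diag (hh : h < n + 1) (σ : Equiv.Perm (Fin n)) :
    AvoidsBlock h (insertCell ⟨h, hh⟩ ⟨h, hh⟩ σ) ↔ AvoidsBlock h σ := by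
  simp only [AvoidsBlock, Fin.forall_iff_succAbove (⟨h, hh⟩ : Fin (n + 1)), insertCell_apply_self,
    insertCell_apply_succAbove, val_succAbove]
  refine ⟨fun H i hi => ?_, fun H => ⟨by simp, fun i hi => ?_⟩⟩
  · have := H.2 i (by simp [hi])
    split_ifs at this <;> omega
  · have := H i (by split_ifs at hi <;> omega)
    split_ifs <;> omega

/-- The first `h` rows keep their index while their values, all at least `h`, move up by one. This
adds `h` to the displacement and changes no other excedance. -/
theorem permWeight_insertCell_diag (hh : h < n + 1) {σ : Equiv.Perm (Fin n)}
    (hσ : AvoidsBlock h σ) :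
    permWeight (insertCell ⟨h, hh⟩ ⟨h, hh⟩ σ) = p * q ^ (2 * h) * t ^ h * permWeight σ := by
  have e1 : inv (insertCell ⟨h, hh⟩ ⟨h, hh⟩ σ) = inv σ + h + h := inv_insertCell _ _ _ hσ
  have e2 : fix (insertCell ⟨h, hh⟩ ⟨h, hh⟩ σ) = 1 + fix σ := by
    rw [fix_insertCell, fix_eq_sum, if_pos rfl]
    congr 1
    refine Finset.sum_congr rfl fun k _ => if_congr ?_ rfl rfl
    simp [Fin.val_inj]
  have e3 : exc (insertCell ⟨h, hh⟩ ⟨h, hh⟩ σ) = exc σ := by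
    rw [exc_insertCell, exc_eq_sum, if_neg (lt_irrefl _), zero_add]
    refine Finset.sum_congr rfl fun k _ => if_congr ?_ rfl rfl
    simp
  have e4 : excSum (insertCell ⟨h, hh⟩ ⟨h, hh⟩ σ) = excSum σ + h := by
    rw [excSum_insertCell, excSum, Nat.sub_self, zero_add]
    rw [← sum_add_ite_val_lt _ (show h ≤ n by omega)]
    refine Finset.sum_congr rfl fun k _ => ?_
    have := hσ k
    simp only [val_succAbove]
    split_ifs <;> omega
  rw [permWeight, permWeight, e1, e2, e3, e4]
  ring

/-- On the left-hand side the first `h` rows avoid columns `0, …, h`; deleting column `v < h` leaves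
`h` columns to avoid. -/
theorem avoidsBlock_insertCell_left (hh : h < n + 1) (v : Fin h) (σ : Equiv.Perm (Fin n)) :
    (AvoidsBlock h (insertCell ⟨h, hh⟩ ⟨v, by omega⟩ σ) ∧
      ∀ i : Fin (n + 1), (i : ℕ) < h → (insertCell ⟨h, hh⟩ ⟨v, by omega⟩ σ i : ℕ) ≠ h) ↔
    AvoidsBlock h σ := by
  have hv := v.2
  simp only [AvoidsBlock, Fin.forall_iff_succAbove (⟨h, hh⟩ : Fin (n + 1)), insertCell_apply_self,
    insertCell_apply_succAbove, val_succAbove]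
  refine ⟨fun H i hi => ?_, fun H => ⟨⟨by simp, fun i hi => ?_⟩, by simp, fun i hi => ?_⟩⟩
  · have h1 := H.1.2 i (by simp [hi])
    have h2 := H.2.2 i (by simp [hi])
    split_ifs at h1 h2 <;> omega
  · have := H i (by split_ifs at hi <;> omega)
    split_ifs <;> omega
  · have := H i (by split_ifs at hi <;> omega)
    split_ifs <;> omega

theorem permWeight_insertCell_left (hh : h < n + 1) (v : Fin h) {σ : Equiv.Perm (Fin n)}
    (hσ : AvoidsBlock h σ) :
    permWeight (insertCell ⟨h, hh⟩ ⟨v, by omega⟩ σ) = q ^ (v : ℕ) * (q * t) ^ h * permWeight σ := by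
  have hv := v.2
  have e1 : inv (insertCell ⟨h, hh⟩ ⟨v, by omega⟩ σ) = inv σ + h + v :=
    inv_insertCell _ _ _ fun k hk => hv.le.trans (hσ k hk)
  have e2 : fix (insertCell ⟨h, hh⟩ ⟨v, by omega⟩ σ) = fix σ := by
    rw [fix_insertCell, fix_eq_sum, if_neg (by simp only; omega), zero_add]
    refine Finset.sum_congr rfl fun k _ => if_congr ?_ rfl rfl
    have := hσ k
    simp only [val_succAbove]
    split_ifs <;> omega
  have e3 : exc (insertCell ⟨h, hh⟩ ⟨v, by omega⟩ σ) = exc σ := by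
    rw [exc_insertCell, exc_eq_sum, if_neg (by simp only; omega), zero_add]
    refine Finset.sum_congr rfl fun k _ => if_congr ?_ rfl rfl
    have := hσ k
    simp only [val_succAbove]
    split_ifs <;> omega
  have e4 : excSum (insertCell ⟨h, hh⟩ ⟨v, by omega⟩ σ) = excSum σ + h := by
    rw [excSum_insertCell, excSum, Nat.sub_eq_zero_of_le hv.le, zero_add]
    rw [← sum_add_ite_val_lt _ (show h ≤ n by omega)]
    refine Finset.sum_congr rfl fun k _ => ?_
    have := hσ k
    simp only [val_succAbove]
    split_ifs <;> omega
  rw [permWeight, permWeight, e1, e2, e3, e4]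
  ring

/-- Since row `u < h` occupies column `h`, the left-hand side says that rows `0, …, h` all avoid
columns below `h`; deleting row `u` leaves `h` such rows. -/
theorem avoidsBlock_insertCell_top (hh : h < n + 1) (u : Fin h) (σ : Equiv.Perm (Fin n)) :
    (AvoidsBlock h (insertCell ⟨u, by omega⟩ ⟨h, hh⟩ σ) ∧
      h < (insertCell ⟨u, by omega⟩ ⟨h, hh⟩ σ ⟨h, hh⟩ : ℕ)) ↔ AvoidsBlock h σ := by
  have hu := u.2
  have key : (AvoidsBlock h (insertCell ⟨u, by omega⟩ ⟨h, hh⟩ σ) ∧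
      h < (insertCell ⟨u, by omega⟩ ⟨h, hh⟩ σ ⟨h, hh⟩ : ℕ)) ↔
      ∀ i : Fin (n + 1), (i : ℕ) ≤ h → h ≤ (insertCell ⟨u, by omega⟩ ⟨h, hh⟩ σ i : ℕ) := by
    refine ⟨fun H i hi => ?_, fun H => ⟨fun i hi => H i hi.le, ?_⟩⟩
    · rcases hi.lt_or_eq with hi | hi
      · exact H.1 i hi
      · obtain rfl : i = ⟨h, hh⟩ := Fin.ext hi
        exact H.2.le
    · refine lt_of_le_of_ne (H ⟨h, hh⟩ le_rfl) fun he => ?_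
      have h1 : insertCell ⟨u, by omega⟩ ⟨h, hh⟩ σ ⟨u, by omega⟩ =
        insertCell ⟨u, by omega⟩ ⟨h, hh⟩ σ ⟨h, hh⟩ :=
        (insertCell_apply_self _ _ σ).trans (Fin.ext he)
      have h2 := congrArg Fin.val ((Equiv.injective _) h1)
      simp only at h2
      omega
  rw [key]
  simp only [AvoidsBlock, Fin.forall_iff_succAbove (⟨u, by omega⟩ : Fin (n + 1)),
    insertCell_apply_self, insertCell_apply_succAbove, val_succAbove]
  refine ⟨fun H i hi => ?_, fun H => ⟨by simp, fun i hi => ?_⟩⟩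
  · have h1 := H.2 i (by split_ifs <;> omega)
    split_ifs at h1 <;> omega
  · have := H i (by split_ifs at hi <;> omega)
    split_ifs <;> omega

/-- The new cell is an excedance of size `h - u`, and each of the `u` rows above it gains one, so
the displacement grows by `h` whatever `u` is. -/
theorem permWeight_insertCell_top (hh : h < n + 1) (u : Fin h) {σ : Equiv.Perm (Fin n)}
    (hσ : AvoidsBlock h σ) :
    permWeight (insertCell ⟨u, by omega⟩ ⟨h, hh⟩ σ) =
      s * q ^ (u : ℕ) * (q * t) ^ h * permWeight σ := by
  have hu := u.2
  have e1 : inv (insertCell ⟨u, by omega⟩ ⟨h, hh⟩ σ) = inv σ + u + h :=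
    inv_insertCell _ _ _ fun k hk => hσ k (lt_trans hk hu)
  have e2 : fix (insertCell ⟨u, by omega⟩ ⟨h, hh⟩ σ) = fix σ := by
    rw [fix_insertCell, fix_eq_sum, if_neg (by simp only; omega), zero_add]
    refine Finset.sum_congr rfl fun k _ => if_congr ?_ rfl rfl
    have := hσ k
    simp only [val_succAbove]
    split_ifs <;> omega
  have e3 : exc (insertCell ⟨u, by omega⟩ ⟨h, hh⟩ σ) = 1 + exc σ := by
    rw [exc_insertCell, exc_eq_sum, if_pos hu]
    congr 1
    refine Finset.sum_congr rfl fun k _ => if_congr ?_ rfl rfl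
    have := hσ k
    simp only [val_succAbove]
    split_ifs <;> omega
  have e4 : excSum (insertCell ⟨u, by omega⟩ ⟨h, hh⟩ σ) = excSum σ + h := by
    have : ∑ k, (((⟨h, hh⟩ : Fin (n + 1)).succAbove (σ k) : ℕ) -
        (⟨u, by omega⟩ : Fin (n + 1)).succAbove k) = excSum σ + u := by
      rw [excSum, ← sum_add_ite_val_lt _ (show (u : ℕ) ≤ n by omega)]
      refine Finset.sum_congr rfl fun k _ => ?_
      have := hσ k
      simp only [val_succAbove]
      split_ifs <;> omega
    rw [excSum_insertCell, this]
    simp only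
    omega
  rw [permWeight, permWeight, e1, e2, e3, e4]
  ring

/-- Insertion of a cell in row `h` and of a cell in column `h`. -/
def insertCorner (hh : h + 1 < n + 2) (u v : Fin (h + 1)) (σ : Equiv.Perm (Fin n)) :
    Equiv.Perm (Fin (n + 2)) :=
  insertCell ⟨h + 1, hh⟩ ⟨v, by omega⟩ (insertCell ⟨u, by omega⟩ ⟨h, by omega⟩ σ)

theorem avoidsBlock_insertCorner (hh : h + 1 < n + 2) (u v : Fin (h + 1))
    (σ : Equiv.Perm (Fin n)) :
    AvoidsBlock (h + 1) (insertCorner hh u v σ) ↔ AvoidsBlock h σ := by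
  have hu := u.2
  have hv := v.2
  simp only [AvoidsBlock, insertCorner, Fin.forall_iff_succAbove (⟨h + 1, hh⟩ : Fin (n + 2)),
    Fin.forall_iff_succAbove (⟨u, by omega⟩ : Fin (n + 1)), insertCell_apply_self,
    insertCell_apply_succAbove, val_succAbove]
  refine ⟨fun H i hi => ?_, fun H => ⟨by simp, fun _ => ?_, fun i hi => ?_⟩⟩
  · have h1 := H.2.2 i (by split_ifs <;> omega)
    split_ifs at h1 <;> omega
  · split_ifs <;> omega
  · have := H i (by split_ifs at hi <;> omega)
    split_ifs <;> omega

theorem permWeight_insertCorner (hh : h + 1 < n + 2) (u v : Fin (h + 1))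
    {σ : Equiv.Perm (Fin n)} (hσ : AvoidsBlock h σ) :
    permWeight (insertCorner hh u v σ) =
      s * q ^ (u : ℕ) * q ^ (v : ℕ) * (q * t) ^ (2 * h + 1) * permWeight σ := by
  have hu := u.2
  have hv := v.2
  -- The inner cell is inserted in column `h`; inserting column `v ≤ h` afterwards pushes it to
  -- column `h + 1`, while its row `u` stays.
  have hval : ((⟨v, by omega⟩ : Fin (n + 2)).succAbove (⟨h, by omega⟩ : Fin (n + 1)) : ℕ) =
      h + 1 := by
    rw [val_succAbove, if_neg (by simp only; omega)]
  have hpos : ((⟨h + 1, hh⟩ : Fin (n + 2)).succAbove (⟨u, by omega⟩ : Fin (n + 1)) : ℕ) = u := by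
    rw [val_succAbove, if_pos hu]
  have e1 : inv (insertCorner hh u v σ) = inv σ + u + h + (h + 1) + v := by
    rw [insertCorner, inv_insertCell, inv_insertCell]
    · exact fun k hk => hσ k (lt_of_lt_of_le hk (Nat.lt_succ_iff.mp hu))
    · intro k
      rcases Fin.eq_self_or_eq_succAbove (⟨u, by omega⟩ : Fin (n + 1)) k with rfl | ⟨k, rfl⟩
      · rw [insertCell_apply_self]
        exact fun _ => Nat.lt_succ_iff.mp hv
      · rw [insertCell_apply_succAbove]
        have := hσ k
        simp only [val_succAbove]
        split_ifs <;> omega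
  have e2 : fix (insertCorner hh u v σ) = fix σ := by
    rw [insertCorner, fix_insertCell, fix_eq_sum σ, if_neg (by simp only; omega), zero_add,
      Fin.sum_univ_succAbove _ ⟨u, by omega⟩, insertCell_apply_self, hval, hpos,
      if_neg (by omega), zero_add]
    refine Finset.sum_congr rfl fun k _ => if_congr ?_ rfl rfl
    rw [insertCell_apply_succAbove]
    have := hσ k
    simp only [val_succAbove]
    split_ifs <;> omega
  have e3 : exc (insertCorner hh u v σ) = 1 + exc σ := by
    rw [insertCorner, exc_insertCell, exc_eq_sum σ, if_neg (by simp only; omega), zero_add,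
      Fin.sum_univ_succAbove _ ⟨u, by omega⟩, insertCell_apply_self, hval, hpos,
      if_pos (by omega)]
    congr 1
    refine Finset.sum_congr rfl fun k _ => if_congr ?_ rfl rfl
    rw [insertCell_apply_succAbove]
    have := hσ k
    simp only [val_succAbove]
    split_ifs <;> omega
  have e4 : excSum (insertCorner hh u v σ) = excSum σ + (2 * h + 1) := by
    have : ∑ k : Fin n, (((⟨v, by omega⟩ : Fin (n + 2)).succAbove
        (insertCell ⟨u, by omega⟩ ⟨h, by omega⟩ σ ((⟨u, by omega⟩ : Fin (n + 1)).succAbove k)) : ℕ) -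
        (⟨h + 1, hh⟩ : Fin (n + 2)).succAbove ((⟨u, by omega⟩ : Fin (n + 1)).succAbove k)) =
        excSum σ + u + h := by
      rw [excSum, ← sum_add_ite_val_lt _ (show (u : ℕ) ≤ n by omega),
        ← sum_add_ite_val_lt _ (show h ≤ n by omega)]
      refine Finset.sum_congr rfl fun k _ => ?_
      rw [insertCell_apply_succAbove]
      have := hσ k
      simp only [val_succAbove]
      split_ifs <;> omega
    rw [insertCorner, excSum_insertCell, Fin.sum_univ_succAbove _ ⟨u, by omega⟩,
      insertCell_apply_self, hval, hpos, this]
    simp only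
    omega
  rw [permWeight, permWeight, e1, e2, e3, e4]
  ring

end Insert

/-! ### The recursion for permutations without a cell in the upper left block -/

theorem sum_fin_ite_eq {M : Type*} [AddCommMonoid M] (h x : ℕ) (R : Prop) [Decidable R] (w : M) :
    (∑ v : Fin h, if R ∧ x = (v : ℕ) then w else 0) = if R ∧ x < h then w else 0 := by
  by_cases hx : x < h
  · rw [Finset.sum_eq_single (⟨x, hx⟩ : Fin h)]
    · simp [hx]
    · intro v _ hv
      exact if_neg fun H => hv (Fin.ext H.2.symm)
    · simp
  · rw [if_neg fun H => hx H.2]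
    exact Finset.sum_eq_zero fun v _ => if_neg fun (H : R ∧ x = v) => hx (H.2 ▸ v.2)

theorem sum_fin_ite_eq_and {M : Type*} [AddCommMonoid M] (h x : ℕ) (R S : Prop) [Decidable R]
    [Decidable S] (w : M) :
    (∑ v : Fin h, if (R ∧ x = (v : ℕ)) ∧ S then w else 0) = if (R ∧ x < h) ∧ S then w else 0 := by
  simp only [and_right_comm (c := S), sum_fin_ite_eq]

/-- The larger block adds only parts of row `h` and column `h`, and these are empty exactly when `τ
h` and `τ⁻¹ h` exceed `h`. -/
theorem avoidsBlock_succ_iff {n h : ℕ} (hh : h < n) (τ : Equiv.Perm (Fin n)) :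
    AvoidsBlock (h + 1) τ ↔
      AvoidsBlock h τ ∧ h < (τ ⟨h, hh⟩ : ℕ) ∧ h < (τ.symm ⟨h, hh⟩ : ℕ) := by
  refine ⟨fun H => ⟨fun i hi => ?_, ?_, ?_⟩, fun H i hi => ?_⟩
  · exact (Nat.le_succ h).trans (H i (by omega))
  · exact H ⟨h, hh⟩ (Nat.lt_succ_self h)
  · by_contra hc
    have := H (τ.symm ⟨h, hh⟩) (by omega)
    simp at this
  · obtain ⟨H1, H2, H3⟩ := H
    rcases (Nat.lt_succ_iff.mp hi).lt_or_eq with hi | hi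
    · refine lt_of_le_of_ne (H1 i hi) fun he => ?_
      rw [show (⟨h, hh⟩ : Fin n) = τ i from Fin.ext he, Equiv.symm_apply_apply] at H3
      omega
    · obtain rfl : i = ⟨h, hh⟩ := Fin.ext hi
      exact H2

theorem sum_avoidsBlock_diag {n h : ℕ} (hh : h < n + 1) :
    (∑ τ : Equiv.Perm (Fin (n + 1)) with AvoidsBlock h τ ∧ τ ⟨h, hh⟩ = ⟨h, hh⟩, permWeight τ) =
      p * q ^ (2 * h) * t ^ h * avoidSum n h := by
  rw [sum_filter_apply_eq _ _ _ (AvoidsBlock h) (avoidsBlock_insertCell_diag hh), avoidSum,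
    Finset.mul_sum]
  exact Finset.sum_congr rfl fun σ hσ =>
    permWeight_insertCell_diag hh (Finset.mem_filter.mp hσ).2

theorem sum_avoidsBlock_left {n h : ℕ} (hh : h < n + 1) (v : Fin h) :
    (∑ τ : Equiv.Perm (Fin (n + 1)) with (AvoidsBlock h τ ∧
        ∀ i : Fin (n + 1), (i : ℕ) < h → (τ i : ℕ) ≠ h) ∧ τ ⟨h, hh⟩ = ⟨v, by omega⟩,
      permWeight τ) = q ^ (v : ℕ) * (q * t) ^ h * avoidSum n h := by
  rw [sum_filter_apply_eq _ _ _ (AvoidsBlock h) (avoidsBlock_insertCell_left hh v), avoidSum,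
    Finset.mul_sum]
  exact Finset.sum_congr rfl fun σ hσ =>
    permWeight_insertCell_left hh v (Finset.mem_filter.mp hσ).2

theorem sum_avoidsBlock_top {n h : ℕ} (hh : h < n + 1) (u : Fin h) :
    (∑ τ : Equiv.Perm (Fin (n + 1)) with (AvoidsBlock h τ ∧ h < (τ ⟨h, hh⟩ : ℕ)) ∧
        τ ⟨u, by omega⟩ = ⟨h, hh⟩,
      permWeight τ) = s * q ^ (u : ℕ) * (q * t) ^ h * avoidSum n h := by
  rw [sum_filter_apply_eq _ _ _ (AvoidsBlock h) (avoidsBlock_insertCell_top hh u), avoidSum,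
    Finset.mul_sum]
  exact Finset.sum_congr rfl fun σ hσ =>
    permWeight_insertCell_top hh u (Finset.mem_filter.mp hσ).2

theorem sum_avoidsBlock_corner {n h : ℕ} (hh : h + 1 < n + 2) (u v : Fin (h + 1)) :
    (∑ τ : Equiv.Perm (Fin (n + 2)) with (AvoidsBlock (h + 1) τ ∧
        τ ⟨u, by omega⟩ = ⟨h + 1, hh⟩) ∧ τ ⟨h + 1, hh⟩ = ⟨v, by omega⟩,
      permWeight τ) =
      s * q ^ (u : ℕ) * q ^ (v : ℕ) * (q * t) ^ (2 * h + 1) * avoidSum n h := by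
  have hu := u.2
  have hv := v.2
  have hval : (⟨v, by omega⟩ : Fin (n + 2)).succAbove (⟨h, by omega⟩ : Fin (n + 1)) =
      ⟨h + 1, hh⟩ := by
    ext
    rw [val_succAbove, if_neg (by simp only; omega)]
  have hpos : (⟨h + 1, hh⟩ : Fin (n + 2)).succAbove (⟨u, by omega⟩ : Fin (n + 1)) =
      ⟨u, by omega⟩ := by
    ext
    rw [val_succAbove, if_pos hu]
  rw [sum_filter_apply_eq _ _ _ (fun σ : Equiv.Perm (Fin (n + 1)) =>
      AvoidsBlock (h + 1) (insertCell ⟨h + 1, hh⟩ ⟨v, by omega⟩ σ) ∧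
        σ ⟨u, by omega⟩ = ⟨h, by omega⟩),
    sum_filter_apply_eq _ _ _ (AvoidsBlock h) (avoidsBlock_insertCorner hh u v), avoidSum,
    Finset.mul_sum]
  · exact Finset.sum_congr rfl fun σ hσ =>
      permWeight_insertCorner hh u v (Finset.mem_filter.mp hσ).2
  · intro σ
    rw [← hpos, insertCell_apply_succAbove, ← hval, Fin.succAbove_right_inj]

theorem qInt_eq_sum_fin (h : ℕ) : qInt h = ∑ i : Fin h, q ^ (i : ℕ) :=
  (Fin.sum_univ_eq_sum_range _ h).symm

/-- The case of two cells is left unevaluated: deleting both also lowers the block size by one,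
which requires `h` to be a successor. For `h = 0` this sum is empty. -/
theorem avoidSum_split {n h : ℕ} (hh : h < n + 1) :
    avoidSum (n + 1) h = avoidSum (n + 1) (h + 1) +
      ((1 + s) * qInt h + p * q ^ h) * (q * t) ^ h * avoidSum n h +
      ∑ u : Fin h, ∑ v : Fin h,
        ∑ τ : Equiv.Perm (Fin (n + 1)) with (AvoidsBlock h τ ∧
          τ ⟨u, by omega⟩ = ⟨h, hh⟩) ∧ τ ⟨h, hh⟩ = ⟨v, by omega⟩, permWeight τ := by
  have hγ : ((1 + s) * qInt h + p * q ^ h) * (q * t) ^ h * avoidSum n h =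
      p * q ^ (2 * h) * t ^ h * avoidSum n h +
      ∑ v : Fin h, q ^ (v : ℕ) * (q * t) ^ h * avoidSum n h +
      ∑ u : Fin h, s * q ^ (u : ℕ) * (q * t) ^ h * avoidSum n h := by
    simp only [mul_assoc, ← Finset.mul_sum, ← Finset.sum_mul]
    rw [qInt_eq_sum_fin]
    ring
  rw [hγ, ← sum_avoidsBlock_diag hh]
  have hcomm : ∀ F : Fin h → Equiv.Perm (Fin (n + 1)) → Poly,
      ∑ v, ∑ τ, F v τ = ∑ τ, ∑ v, F v τ := fun _ => Finset.sum_comm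
  simp only [← sum_avoidsBlock_left hh, ← sum_avoidsBlock_top hh]
  simp only [avoidSum, Finset.sum_filter, hcomm]
  simp only [← Finset.sum_add_distrib]
  refine Finset.sum_congr rfl fun τ _ => ?_
  have e1 : ∀ u : Fin h, τ ⟨u, by omega⟩ = ⟨h, hh⟩ ↔ (τ.symm ⟨h, hh⟩ : ℕ) = u := by
    intro u
    rw [← Equiv.eq_symm_apply, eq_comm, Fin.ext_iff]
  have e2 : (∀ i : Fin (n + 1), (i : ℕ) < h → (τ i : ℕ) ≠ h) ↔
      ¬ (τ.symm ⟨h, hh⟩ : ℕ) < h := by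
    refine ⟨fun H hlt => H _ hlt (by simp), fun H i hi he => H ?_⟩
    rwa [show (⟨h, hh⟩ : Fin (n + 1)) = τ i from Fin.ext he.symm, Equiv.symm_apply_apply]
  have e3 : (τ ⟨h, hh⟩ : ℕ) = h ↔ (τ.symm ⟨h, hh⟩ : ℕ) = h := by
    have : τ ⟨h, hh⟩ = ⟨h, hh⟩ ↔ τ.symm ⟨h, hh⟩ = ⟨h, hh⟩ := by
      rw [Equiv.symm_apply_eq, eq_comm]
    simpa [Fin.ext_iff] using this
  simp only [avoidsBlock_succ_iff hh, e1, e2, Fin.ext_iff (a := τ ⟨h, hh⟩), sum_fin_ite_eq,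
    sum_fin_ite_eq_and]
  by_cases hA : AvoidsBlock h τ
  · simp only [hA, true_and]
    -- Comparing `τ h` and `τ⁻¹ h` with `h` puts each `τ` in exactly one of the five cases; by `e3`,
    -- equality holds for both or for neither.
    split_ifs <;> first | omega | simp
  · simp [hA]

theorem avoidSum_zero_succ (n : ℕ) :
    avoidSum (n + 1) 0 = avoidSum (n + 1) 1 + p * avoidSum n 0 := by
  rw [avoidSum_split (Nat.succ_pos n)]
  simp [qInt]

theorem avoidSum_succ_succ {n h : ℕ} (hh : h + 1 < n + 2) :
    avoidSum (n + 2) (h + 1) = avoidSum (n + 2) (h + 2) +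
      ((1 + s) * qInt (h + 1) + p * q ^ (h + 1)) * (q * t) ^ (h + 1) * avoidSum (n + 1) (h + 1) +
      s * qInt (h + 1) ^ 2 * (q * t) ^ (2 * (h + 1) - 1) * avoidSum n h := by
  rw [avoidSum_split hh]
  congr 1
  simp only [sum_avoidsBlock_corner hh, ← Finset.mul_sum, ← Finset.sum_mul]
  rw [← qInt_eq_sum_fin]
  rw [show 2 * (h + 1) - 1 = 2 * h + 1 by omega]
  ring

theorem avoidSum_self (h : ℕ) : avoidSum (h + 1) (h + 1) = 0 := by
  rw [avoidSum, Finset.sum_eq_zero]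
  intro σ hσ
  have := (Finset.mem_filter.mp hσ).2 0 (Nat.succ_pos h)
  exact absurd (σ 0).2 (not_lt.mpr this)

theorem avoidSum_zero_zero : avoidSum 0 0 = 1 := by
  rw [avoidSum, Finset.sum_filter, Fintype.sum_unique]
  simp [AvoidsBlock, permWeight, inv, fix, exc, excSum]

/-! ### Weighted Motzkin paths and J-fractions -/

/-- The generating polynomial of Motzkin paths with `m` steps from height `h` to height `0`, with
weight `a (h + 1)` for an up step, `b h` for a down step and `γ h` for a horizontal step that
starts at height `h`. -/
def pathSum {R : Type*} [CommRing R] (a b γ : ℕ → R) : ℕ → ℕ → R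
  | 0, h => if h = 0 then 1 else 0
  | m + 1, h => a (h + 1) * pathSum a b γ m (h + 1) + γ h * pathSum a b γ m h +
      b h * pathSum a b γ m (h - 1)

/-- Each up step is matched with a later down step of the same height, so only the product `a h * b
h` matters, except for the `h` unmatched down steps, which yield the prefactor. The vanishing of
`lam 0` and `b 0` kills the term where `h - 1` truncates at height `0`. -/
theorem pathSum_rescale {R : Type*} [CommRing R] (a b γ lam : ℕ → R) (h0 : lam 0 = 0)
    (hb0 : b 0 = 0) (hab : ∀ h, a (h + 1) * b (h + 1) = lam (h + 1)) (m h : ℕ) :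
    pathSum 1 lam γ m h = (∏ i ∈ Finset.range h, a (i + 1)) * pathSum a b γ m h := by
  induction m generalizing h with
  | zero =>
    rcases h with _ | h
    · simp [pathSum]
    · simp [pathSum]
  | succ m ih =>
    rw [pathSum, pathSum, ih, ih, ih]
    rcases h with _ | h
    · simp [h0, hb0]
    · rw [← hab, Nat.add_sub_cancel, Finset.prod_range_succ _ (h + 1), Finset.prod_range_succ _ h,
        Pi.one_apply]
      ring

/-- Decomposing a path at its last visits to the levels `h, …, 1` gives one factor `X * lam i` per
final descent and one J-fraction per level. The depths `K - i` make consecutive convergents fit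
together exactly, so no truncation error arises while `m + h < K`. -/
theorem pathSum_eq_coeff {R : Type*} [CommRing R] (γ lam : ℕ → R) (h0 : lam 0 = 0) (K m h : ℕ)
    (hK : m + h < K) :
    pathSum 1 lam γ m h = PowerSeries.coeff m
      (PowerSeries.X ^ h * (∏ i ∈ Finset.range h, PowerSeries.C (lam (i + 1))) *
        ∏ i ∈ Finset.range (h + 1), jConvergent γ lam (K - i) i) := by
  set Q : ℕ → R⟦X⟧ := fun h =>
    PowerSeries.X ^ h * (∏ i ∈ Finset.range h, PowerSeries.C (lam (i + 1))) *
        ∏ i ∈ Finset.range (h + 1), jConvergent γ lam (K - i) i with hQ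
  change _ = PowerSeries.coeff m (Q h)
  have hJ : ∀ h < K, (1 - PowerSeries.C (γ h) * PowerSeries.X
      - PowerSeries.C (lam (h + 1)) * PowerSeries.X ^ 2 * jConvergent γ lam (K - (h + 1)) (h + 1))
      * jConvergent γ lam (K - h) h = 1 := by
    intro h hh
    obtain ⟨k, hk⟩ : ∃ k, K - h = k + 1 := ⟨K - h - 1, by omega⟩
    rw [hk, show K - (h + 1) = k by omega]
    exact jConvergent_succ_mul γ lam k h
  -- The products `Q h` satisfy the first-step recursion of `pathSum`; it is the convergent identity
  -- `hJ` multiplied by the remaining factors of `Q h`.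
  have hrec : ∀ h < K, Q h = (if h = 0 then 1 else 0) +
      PowerSeries.X * (Q (h + 1) + PowerSeries.C (γ h) * Q h +
        PowerSeries.C (lam h) * Q (h - 1)) := by
    intro h hh
    have e := hJ h hh
    rcases h with _ | h
    · simp only [hQ, h0, Finset.prod_range_succ, Finset.prod_range_zero, Nat.sub_zero] at e ⊢
      simp only [map_zero, if_true]
      linear_combination e
    · simp only [hQ, Nat.add_sub_cancel]
      rw [Finset.prod_range_succ _ (h + 1 + 1), Finset.prod_range_succ _ (h + 1),
        Finset.prod_range_succ (fun i => PowerSeries.C (lam (i + 1))) (h + 1),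
        Finset.prod_range_succ (fun i => PowerSeries.C (lam (i + 1))) h]
      simp only [Nat.add_eq_zero_iff, one_ne_zero, and_false, if_false]
      linear_combination (PowerSeries.X ^ (h + 1) *
        (∏ i ∈ Finset.range h, PowerSeries.C (lam (i + 1))) * PowerSeries.C (lam (h + 1)) *
        ∏ i ∈ Finset.range (h + 1), jConvergent γ lam (K - i) i) * e
  clear_value Q
  induction m generalizing h with
  | zero =>
    rw [hrec h (by omega), pathSum]
    simp only [map_add, PowerSeries.coeff_zero_X_mul, add_zero]
    split_ifs <;> simp
  | succ m ih =>
    rw [hrec h (by omega), pathSum, ih _ (by omega), ih _ (by omega), ih _ (by omega)]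
    simp only [map_add, PowerSeries.coeff_succ_X_mul, PowerSeries.coeff_C_mul, Pi.one_apply]
    split_ifs <;> simp [PowerSeries.coeff_one]

/-- Flajolet's theorem: a J-fraction is the generating function of weighted Motzkin paths. -/
theorem mk_pathSum_eq_jFraction {R : Type*} [CommRing R] (γ lam : ℕ → R) (h0 : lam 0 = 0) :
    (PowerSeries.mk fun n => pathSum 1 lam γ n 0) = jFraction γ lam := by
  ext n
  rw [PowerSeries.coeff_mk, jFraction, PowerSeries.coeff_mk,
    pathSum_eq_coeff γ lam h0 (n + 1) n 0 (by omega)]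
  simp

/-! ### Weighted paths from an arbitrary starting height -/

theorem yCoord_cons_succ {n : ℕ} (a : Step) (x : Fin n → Step) (k : ℕ) :
    yCoord (Fin.cons a x : Fin (n + 1) → Step) (k + 1) = a.dy + yCoord x k := by
  simp [yCoord, Finset.sum_filter, Fin.sum_univ_succ]

theorem yCoord_zero {n : ℕ} (x : Fin n → Step) : yCoord x 0 = 0 := by simp [yCoord]

/-- The sequence of steps and weights is a weighted path from height `h` to height `0`. -/
def IsWeightedPathFrom {n : ℕ} (h : ℤ) (f : Fin n → Step × Poly) : Prop :=
  (∀ k ≤ n, 0 ≤ h + yCoord (fun i => (f i).1) k) ∧ h + yCoord (fun i => (f i).1) n = 0 ∧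
    ∀ i : Fin n, (f i).2 ∈ stepWeights (f i).1
      (max (h + yCoord (fun i => (f i).1) i) (h + yCoord (fun i => (f i).1) (i + 1))).toNat

theorem isWeightedPathFrom_cons {n : ℕ} (h : ℤ) (a : Step × Poly) (f : Fin n → Step × Poly) :
    IsWeightedPathFrom h (Fin.cons a f : Fin (n + 1) → Step × Poly) ↔
      0 ≤ h ∧ a.2 ∈ stepWeights a.1 (max h (h + a.1.dy)).toNat ∧
        IsWeightedPathFrom (h + a.1.dy) f := by
  have e : (fun i => ((Fin.cons a f : Fin (n + 1) → Step × Poly) i).1) =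
      Fin.cons a.1 fun i => (f i).1 := by
    ext i
    refine Fin.cases ?_ (fun i => ?_) i <;> simp
  rw [IsWeightedPathFrom, IsWeightedPathFrom, e, Fin.forall_fin_succ]
  simp only [Fin.cons_zero, Fin.cons_succ, Fin.val_zero, Fin.val_succ, yCoord_cons_succ,
    yCoord_zero, add_zero, zero_add, ← add_assoc]
  constructor
  · rintro ⟨h1, h2, h3, h4⟩
    refine ⟨by simpa [yCoord_zero] using h1 0 (Nat.zero_le _), ?_, fun k hk => ?_, h2, h4⟩
    · have := yCoord_cons_succ a.1 (fun i => (f i).1) 0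
      simpa [yCoord_zero, this] using h3
    · have := h1 (k + 1) (by omega)
      rwa [yCoord_cons_succ, ← add_assoc] at this
  · rintro ⟨h1, h2, h3, h4, h5⟩
    refine ⟨fun k hk => ?_, h4, ?_, h5⟩
    · rcases k with _ | k
      · simpa [yCoord_zero] using h1
      · rw [yCoord_cons_succ, ← add_assoc]
        exact h3 k (by omega)
    · have := yCoord_cons_succ a.1 (fun i => (f i).1) 0
      simpa [yCoord_zero, this] using h2

/-! ### Total weight of the admissible choices for a step -/

theorem q_pow_injective : Function.Injective fun d : ℕ => q ^ d := by
  intro a b hab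
  simp only [q, MvPolynomial.X_pow_eq_monomial] at hab
  have := (MvPolynomial.monomial_left_injective (R := ℤ) one_ne_zero) hab
  simpa using DFunLike.congr_fun this 0

open scoped Classical in
/-- The finite set of admissible weights of a step at height `h`. -/
noncomputable def stepWeightFinset : Step → ℕ → Finset Poly
  | .U, h => (Finset.range h).image fun d => s * t ^ (2 * h - 1) * q ^ d
  | .D, h => (Finset.range h).image fun d => q ^ (2 * h - 1) * q ^ d
  | .H1, h => (Finset.range h).image fun d => s * t ^ h * q ^ h * q ^ d
  | .H2, h => (Finset.range h).image fun d => t ^ h * q ^ h * q ^ d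
  | .H3, h => {p * t ^ h * q ^ (2 * h)}

theorem mem_stepWeightFinset (a : Step) (h : ℕ) (w : Poly) :
    w ∈ stepWeightFinset a h ↔ w ∈ stepWeights a h := by
  cases a <;> simp [stepWeightFinset, stepWeights, pow_add, mul_assoc, eq_comm]

open scoped Classical in
-- Weights are chosen from a set, so distinct `d` must give distinct weights for the sum to be a
-- full `q`-integer.
theorem sum_image_mul_q_pow (c : Poly) (hc : c ≠ 0) (h : ℕ) :
    ∑ w ∈ (Finset.range h).image (fun d => c * q ^ d), w = c * qInt h := by
  rw [Finset.sum_image, qInt, Finset.mul_sum]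
  intro a _ b _ hab
  exact q_pow_injective (mul_left_cancel₀ hc hab)

theorem q_ne_zero : q ≠ 0 := MvPolynomial.X_ne_zero 0
theorem s_ne_zero : s ≠ 0 := MvPolynomial.X_ne_zero 2
theorem t_ne_zero : t ≠ 0 := MvPolynomial.X_ne_zero 3

theorem sum_stepWeightFinset_U (h : ℕ) :
    ∑ w ∈ stepWeightFinset .U h, w = s * t ^ (2 * h - 1) * qInt h :=
  sum_image_mul_q_pow _ (mul_ne_zero s_ne_zero (pow_ne_zero _ t_ne_zero)) h

theorem sum_stepWeightFinset_D (h : ℕ) :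
    ∑ w ∈ stepWeightFinset .D h, w = q ^ (2 * h - 1) * qInt h :=
  sum_image_mul_q_pow _ (pow_ne_zero _ q_ne_zero) h

theorem sum_stepWeightFinset_H1 (h : ℕ) :
    ∑ w ∈ stepWeightFinset .H1 h, w = s * t ^ h * q ^ h * qInt h :=
  sum_image_mul_q_pow _ (mul_ne_zero (mul_ne_zero s_ne_zero (pow_ne_zero _ t_ne_zero))
    (pow_ne_zero _ q_ne_zero)) h

theorem sum_stepWeightFinset_H2 (h : ℕ) :
    ∑ w ∈ stepWeightFinset .H2 h, w = t ^ h * q ^ h * qInt h :=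
  sum_image_mul_q_pow _ (mul_ne_zero (pow_ne_zero _ t_ne_zero) (pow_ne_zero _ q_ne_zero)) h

theorem sum_stepWeightFinset_H3 (h : ℕ) :
    ∑ w ∈ stepWeightFinset .H3 h, w = p * t ^ h * q ^ (2 * h) :=
  Finset.sum_singleton _ _

/-- The height of a step that starts at height `h`. -/
def Step.heightFrom : Step → ℕ → ℕ
  | .U, h => h + 1
  | _, h => h

/-- The height at which a step ends that starts at height `h`. -/
def Step.next : Step → ℕ → ℕ
  | .U, h => h + 1
  | .D, h => h - 1
  | _, h => h

theorem mem_stepWeights_and_path_iff {n : ℕ} (a : Step) (h : ℕ) (w : Poly)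
    (f : Fin n → Step × Poly) :
    (w ∈ stepWeights a (max (h : ℤ) (h + a.dy)).toNat ∧ IsWeightedPathFrom (h + a.dy) f) ↔
      w ∈ stepWeights a (a.heightFrom h) ∧ IsWeightedPathFrom (a.next h : ℤ) f := by
  cases a
  · have : (max (h : ℤ) (h + 1)).toNat = h + 1 := by omega
    simp only [Step.dy, Step.heightFrom, Step.next, this, Nat.cast_add, Nat.cast_one]
  · have : max (h : ℤ) (h + -1) = (h : ℤ) := max_eq_left (by omega)
    simp only [Step.dy, Step.heightFrom, Step.next, this, Int.toNat_natCast]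
    -- At height `0` a down step has no admissible weight, so the truncated `0 - 1` in `Step.next`
    -- is harmless.
    rcases h with _ | h
    · simp [stepWeights]
    · simp
  all_goals simp [Step.dy, Step.heightFrom, Step.next]

instance : Fintype Step :=
  ⟨⟨([.U, .D, .H1, .H2, .H3] : List Step), by simp⟩, fun a => by cases a <;> simp⟩

theorem sum_univ_step {M : Type*} [AddCommMonoid M] (f : Step → M) :
    ∑ a, f a = f .U + (f .D + (f .H1 + (f .H2 + f .H3))) := by
  change Multiset.sum (Multiset.map f ([Step.U, .D, .H1, .H2, .H3] : List Step)) = _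
  simp

open scoped Classical in
/-- The weighted paths with `n` steps from height `h` to height `0`. -/
noncomputable def pathFinset : (n : ℕ) → ℕ → Finset (Fin n → Step × Poly)
  | 0, h => if h = 0 then Finset.univ else ∅
  | n + 1, h => Finset.univ.biUnion fun a : Step => (stepWeightFinset a (a.heightFrom h) ×ˢ
      pathFinset n (a.next h)).image fun x => Fin.cons (a, x.1) x.2

theorem mem_pathFinset {n : ℕ} (h : ℕ) (f : Fin n → Step × Poly) :
    f ∈ pathFinset n h ↔ IsWeightedPathFrom (h : ℤ) f := by
  induction n generalizing h with
  | zero =>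
    rw [pathFinset, IsWeightedPathFrom]
    by_cases hh : h = 0 <;> simp [hh, yCoord, eq_iff_true_of_subsingleton]
  | succ n ih =>
    rw [← Fin.cons_self_tail f, isWeightedPathFrom_cons, mem_stepWeights_and_path_iff, pathFinset]
    simp only [Finset.mem_biUnion, Finset.mem_univ, true_and, Finset.mem_image, Finset.mem_product,
      mem_stepWeightFinset, ih, Fin.cons_inj, Nat.cast_nonneg]
    constructor
    · rintro ⟨a, ⟨w, g⟩, ⟨h1, h2⟩, h3, h4⟩
      rw [← h3, ← h4]
      exact ⟨h1, h2⟩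
    · rintro ⟨h1, h2⟩
      exact ⟨(f 0).1, ⟨(f 0).2, Fin.tail f⟩, ⟨h1, h2⟩, rfl, rfl⟩

open scoped Classical in
theorem sum_pathFinset (n h : ℕ) :
    ∑ f ∈ pathFinset n h, ∏ i, (f i).2 =
      pathSum (fun h => s * t ^ (2 * h - 1) * qInt h) (fun h => q ^ (2 * h - 1) * qInt h)
        (fun h => ((1 + s) * qInt h + p * q ^ h) * (q * t) ^ h) n h := by
  induction n generalizing h with
  | zero =>
    rw [pathFinset, pathSum]
    split_ifs <;> simp
  | succ n ih =>
    rw [pathFinset, Finset.sum_biUnion, pathSum]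
    · have key : ∀ a : Step, ∑ f ∈ (stepWeightFinset a (a.heightFrom h) ×ˢ
          pathFinset n (a.next h)).image (fun x => (Fin.cons (a, x.1) x.2 :
            Fin (n + 1) → Step × Poly)), ∏ i, (f i).2 =
          (∑ w ∈ stepWeightFinset a (a.heightFrom h), w) *
            ∑ f ∈ pathFinset n (a.next h), ∏ i, (f i).2 := by
        intro a
        rw [Finset.sum_image, Finset.sum_product, Finset.sum_mul_sum]
        · simp [Fin.prod_univ_succ]
        · intro x _ y _ hxy
          obtain ⟨h1, h2⟩ := Fin.cons_inj.mp hxy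
          exact Prod.ext (congrArg Prod.snd h1) h2
      rw [Finset.sum_congr rfl fun a _ => key a, sum_univ_step]
      simp only [ih, Step.heightFrom, Step.next, sum_stepWeightFinset_U,
        sum_stepWeightFinset_D, sum_stepWeightFinset_H1, sum_stepWeightFinset_H2,
        sum_stepWeightFinset_H3]
      ring
    · intro a _ b _ hab
      rw [Function.onFun, Finset.disjoint_left]
      intro f hf hg
      obtain ⟨x, _, rfl⟩ := Finset.mem_image.mp hf
      obtain ⟨y, _, hy⟩ := Finset.mem_image.mp hg
      exact hab (congrArg Prod.fst (Fin.cons_inj.mp hy).1).symm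

/-- Weighted paths as the sequences of steps and weights in `pathFinset n 0`. -/
noncomputable def weightedPathEquiv (n : ℕ) : WeightedPath n ≃ pathFinset n 0 where
  toFun μ := ⟨fun i => (μ.step i, μ.stepWeight i), by
    rw [mem_pathFinset]
    refine ⟨fun k hk => ?_, ?_, fun i => ?_⟩
    · simpa using μ.isMotzkin.1 k hk
    · simpa using μ.isMotzkin.2
    · simpa [height] using μ.stepWeight_mem i⟩
  invFun f :=
    { step := fun i => (f.1 i).1
      stepWeight := fun i => (f.1 i).2
      isMotzkin := by
        obtain ⟨h1, h2, -⟩ := (mem_pathFinset 0 f.1).mp f.2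
        exact ⟨fun k hk => by simpa using h1 k hk, by simpa using h2⟩
      stepWeight_mem := fun i => by
        have := ((mem_pathFinset 0 f.1).mp f.2).2.2 i
        simpa [height] using this }
  left_inv _ := rfl
  right_inv _ := rfl

noncomputable instance (n : ℕ) : Fintype (WeightedPath n) :=
  Fintype.ofEquiv _ (weightedPathEquiv n).symm

theorem sum_weight_eq (n : ℕ) :
    ∑ μ : WeightedPath n, μ.weight =
      pathSum (fun h => s * t ^ (2 * h - 1) * qInt h) (fun h => q ^ (2 * h - 1) * qInt h)
        (fun h => ((1 + s) * qInt h + p * q ^ h) * (q * t) ^ h) n 0 := by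
  rw [← sum_pathFinset, ← Finset.sum_coe_sort (pathFinset n 0),
    ← (weightedPathEquiv n).sum_comp]
  rfl

/-! ### Families of monomials with the same sum -/

/-- The monic monomials. -/
noncomputable def monomials : Submonoid Poly :=
  MonoidHom.mrange (MvPolynomial.monomialOneHom ℤ (Fin 4))

theorem X_mem_monomials (i : Fin 4) : (MvPolynomial.X i : Poly) ∈ monomials :=
  ⟨Multiplicative.ofAdd (Finsupp.single i 1), rfl⟩

theorem stepWeights_subset_monomials (a : Step) (h : ℕ) : stepWeights a h ⊆ monomials := by
  have hq : q ∈ monomials := X_mem_monomials 0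
  have hp : p ∈ monomials := X_mem_monomials 1
  have hs : s ∈ monomials := X_mem_monomials 2
  have ht : t ∈ monomials := X_mem_monomials 3
  intro w hw
  cases a
  · obtain ⟨d, _, rfl⟩ := hw
    exact mul_mem (mul_mem hs (pow_mem ht _)) (pow_mem hq _)
  · obtain ⟨d, _, rfl⟩ := hw
    exact pow_mem hq _
  · obtain ⟨d, _, rfl⟩ := hw
    exact mul_mem (mul_mem hs (pow_mem ht _)) (pow_mem hq _)
  · obtain ⟨d, _, rfl⟩ := hw
    exact mul_mem (pow_mem ht _) (pow_mem hq _)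
  · rw [Set.mem_singleton_iff.mp hw]
    exact mul_mem (mul_mem hp (pow_mem ht _)) (pow_mem hq _)

theorem WeightedPath.weight_mem_monomials {n : ℕ} (μ : WeightedPath n) : μ.weight ∈ monomials :=
  prod_mem fun i _ => stepWeights_subset_monomials _ _ (μ.stepWeight_mem i)

/-- Every summand is a monomial with coefficient `1`, so a coefficient of the sum is a multiplicity.
-/
theorem coeff_sum_of_mem_monomials {α : Type*} [Fintype α] [DecidableEq Poly] (f : α → Poly)
    (hf : ∀ a, f a ∈ monomials) (v : Fin 4 →₀ ℕ) :
    MvPolynomial.coeff v (∑ a, f a) =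
      (Fintype.card {a // f a = MvPolynomial.monomial v 1} : ℤ) := by
  rw [MvPolynomial.coeff_sum, Fintype.card_subtype, Finset.card_filter, Nat.cast_sum]
  refine Finset.sum_congr rfl fun a _ => ?_
  obtain ⟨u, hu⟩ := hf a
  have hu' : f a = MvPolynomial.monomial u.toAdd 1 := hu.symm
  simp only [hu', MvPolynomial.coeff_monomial,
    (MvPolynomial.monomial_left_injective (R := ℤ) one_ne_zero).eq_iff]
  simp

/-- Two finite families of monomials with the same sum agree up to a bijection of the index
types. -/
theorem exists_bijective_of_sum_eq {α β : Type*} [Fintype α] [Fintype β] (f : α → Poly)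
    (g : β → Poly) (hf : ∀ a, f a ∈ monomials) (hg : ∀ b, g b ∈ monomials)
    (h : ∑ a, f a = ∑ b, g b) :
    ∃ Ψ : α → β, Function.Bijective Ψ ∧ ∀ a, g (Ψ a) = f a := by
  classical
  have hcard : ∀ w, Nonempty ({a // f a = w} ≃ {b // g b = w}) := by
    intro w
    rw [← Fintype.card_eq]
    by_cases hw : w ∈ monomials
    · obtain ⟨v, rfl⟩ := hw
      have := coeff_sum_of_mem_monomials f hf v.toAdd
      rw [h, coeff_sum_of_mem_monomials g hg v.toAdd] at this
      exact_mod_cast this.symm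
    · rw [Fintype.card_eq_zero_iff.mpr ⟨fun (a : {a // f a = w}) => hw (a.2 ▸ hf a.1)⟩,
        Fintype.card_eq_zero_iff.mpr ⟨fun (b : {b // g b = w}) => hw (b.2 ▸ hg b.1)⟩]
  let e := fun w => (hcard w).some
  exact ⟨_, (Equiv.ofFiberEquiv e).bijective, Equiv.ofFiberEquiv_map e⟩

/-! ### Permutations and weighted paths -/

/-- The number of steps is matrix size minus block size: each case of the recursion lowers this
difference by one. At difference `0` with `h > 0` row `0` has no room for its cell. -/
theorem avoidSum_eq_pathSum (m h : ℕ) :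
    avoidSum (m + h) h = pathSum 1 (fun h => s * qInt h ^ 2 * (q * t) ^ (2 * h - 1))
      (fun h => ((1 + s) * qInt h + p * q ^ h) * (q * t) ^ h) m h := by
  induction m generalizing h with
  | zero =>
    rw [zero_add, pathSum]
    rcases h with _ | h
    · simp [avoidSum_zero_zero]
    · simp [avoidSum_self]
  | succ m ih =>
    rw [pathSum, ← ih, ← ih, ← ih, Pi.one_apply, one_mul]
    rcases h with _ | h
    · simp [avoidSum_zero_succ, qInt]
    · rw [show m + 1 + (h + 1) = m + h + 2 by ring, avoidSum_succ_succ (by omega)]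
      rfl

theorem sum_permWeight_eq_avoidSum (n : ℕ) :
    ∑ σ : Equiv.Perm (Fin n), permWeight σ = avoidSum n 0 := by
  simp [avoidSum, AvoidsBlock]

theorem qInt_zero : qInt 0 = 0 := Finset.sum_range_zero _

theorem sum_permWeight_eq_sum_weight (n : ℕ) :
    ∑ σ : Equiv.Perm (Fin n), permWeight σ = ∑ μ : WeightedPath n, μ.weight := by
  rw [sum_permWeight_eq_avoidSum, sum_weight_eq]
  refine (avoidSum_eq_pathSum n 0).trans ((pathSum_rescale
    (fun h => s * t ^ (2 * h - 1) * qInt h) (fun h => q ^ (2 * h - 1) * qInt h)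
    _ _ ?_ ?_ ?_ n 0).trans ?_)
  · simp [qInt_zero]
  · simp [qInt_zero]
  · intro h
    rw [mul_pow]
    ring
  · simp

theorem permWeight_mem_monomials {n : ℕ} (σ : Equiv.Perm (Fin n)) : permWeight σ ∈ monomials :=
  mul_mem (mul_mem (mul_mem (pow_mem (X_mem_monomials 0) _) (pow_mem (X_mem_monomials 1) _))
    (pow_mem (X_mem_monomials 2) _)) (pow_mem (X_mem_monomials 3) _)

end MotzkinPerm

theorem theorem1 :
    (∀ n : ℕ, ∃ Ψ : Equiv.Perm (Fin n) → MotzkinPerm.WeightedPath n,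
      Function.Bijective Ψ ∧
      ∀ σ : Equiv.Perm (Fin n),
        (Ψ σ).weight =
          MotzkinPerm.q ^ MotzkinPerm.inv σ * MotzkinPerm.p ^ MotzkinPerm.fix σ *
            MotzkinPerm.s ^ MotzkinPerm.exc σ * MotzkinPerm.t ^ MotzkinPerm.depth σ) ∧
    (PowerSeries.mk fun n : ℕ =>
        ∑ σ : Equiv.Perm (Fin n),
          MotzkinPerm.q ^ MotzkinPerm.inv σ * MotzkinPerm.p ^ MotzkinPerm.fix σ *
            MotzkinPerm.s ^ MotzkinPerm.exc σ * MotzkinPerm.t ^ MotzkinPerm.depth σ) =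
      MotzkinPerm.jFraction
        (fun h => ((1 + MotzkinPerm.s) * MotzkinPerm.qInt h +
          MotzkinPerm.p * MotzkinPerm.q ^ h) * (MotzkinPerm.q * MotzkinPerm.t) ^ h)
        (fun h => MotzkinPerm.s * MotzkinPerm.qInt h ^ 2 *
          (MotzkinPerm.q * MotzkinPerm.t) ^ (2 * h - 1)) := by
  have hw : ∀ {n : ℕ} (σ : Equiv.Perm (Fin n)),
      MotzkinPerm.q ^ MotzkinPerm.inv σ * MotzkinPerm.p ^ MotzkinPerm.fix σ *
        MotzkinPerm.s ^ MotzkinPerm.exc σ * MotzkinPerm.t ^ MotzkinPerm.depth σ =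
      MotzkinPerm.permWeight σ := fun σ => by
    rw [MotzkinPerm.depth_eq_excSum, MotzkinPerm.permWeight]
  simp only [hw]
  constructor
  · intro n
    exact MotzkinPerm.exists_bijective_of_sum_eq _ _ MotzkinPerm.permWeight_mem_monomials
      MotzkinPerm.WeightedPath.weight_mem_monomials (MotzkinPerm.sum_permWeight_eq_sum_weight n)
  · rw [← MotzkinPerm.mk_pathSum_eq_jFraction _ _ (by simp [MotzkinPerm.qInt_zero])]
    congr 1
    ext1 n
    rw [MotzkinPerm.sum_permWeight_eq_avoidSum]
    exact MotzkinPerm.avoidSum_eq_pathSum n 0
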